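/- Let $N\ge 2$ and $n\ge N$ be integers and put $a:=n-N$. The eigenvalue probability density function of the fixed trace Laguerre unitary ensemble (eigenvalues of $G^\dagger G/\mathrm{Tr}\,G^\dagger G$ for an $n\times N$ standard complex Gaussian matrix $G$) is $$p(\lambda_1,\dots,\lambda_N)=\frac1{C}\,\delta\Big(1-\sum_{l=1}^N\lambda_l\Big)\prod_{l=1}^N\lambda_l^a\prod_{1\le j<k\le N}(\lambda_k-\lambda_j)^2,\qquad \lambda_l\in(0,1),$$ $$C=\frac{N!}{\Gamma(aN+N^2)}\prod_{l=0}^{N-1}\Gamma(l+1)\Gamma(a+l+1).$$ Let $$\rho(x)=N\int_0^1 d\lambda_2\cdots\int_0^1 d\lambda_N\;p(x,\lambda_2,\dots,\lambda_N)$$ be the corresponding eigenvalue density. Then for every $x\in(0,1)$ this integral converges, $\rho$ is three times continuously differentiable on $(0,1)$, and for all $x\in(0,1)$ $$a_3(x)\rho'''(x)+a_2(x)\rho''(x)+a_1(x)\rho'(x)+a_0(x)\rho(x)=0,$$ where $$\begin{aligned} a_0(x)&=x(2N+a)(N^2+aN-2)-a^2,\\ a_1(x)&=-x\big(x^2(N^2+aN-4)(N^2+aN-3)-x(2N+a)(2N^2+2aN-7)+a^2-2\big),\\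 a_2(x)&=2x^2\big(x^2(N^2+Na-4)-x(2N+a)+2\big),\\ a_3(x)&=x^3(1-x^2). \end{aligned}$$ -/

import Mathlib

open MeasureTheory

noncomputable section

/-- The measure `δ(t - ∑ l, y l) dy_1 ⋯ dy_{m+1}` on `ℝ^{m+1}`: the delta function is resolved by
integrating out the last variable, so the last coordinate becomes `t` minus the sum of the others,
which are distributed by Lebesgue measure on `ℝ^m`. -/
def traceDelta (m : ℕ) (t : ℝ) : Measure (Fin (m + 1) → ℝ) :=
  Measure.map (fun y : Fin m → ℝ => (Fin.snoc y (t - ∑ i, y i) : Fin (m + 1) → ℝ)) volume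

/-- The normalisation `N! / Γ(aN + N²) · ∏_{l=0}^{N-1} Γ(l+1) Γ(a+l+1)` of the fixed trace Laguerre
unitary ensemble. -/
def fLUENorm (N a : ℕ) : ℝ :=
  (N.factorial : ℝ) / Real.Gamma ((a : ℝ) * N + (N : ℝ) ^ 2) *
    ∏ l ∈ Finset.range N, Real.Gamma ((l : ℝ) + 1) * Real.Gamma ((a : ℝ) + l + 1)

/-- The eigenvalue PDF of the fixed trace Laguerre unitary ensemble apart from its factor
`δ(1 - ∑ l, v l)`, supported on `(0,1)^N`. -/
def fLUEFactor (N a : ℕ) (v : Fin N → ℝ) : ℝ :=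
  Set.indicator (Set.univ.pi fun _ => Set.Ioo (0 : ℝ) 1)
    (fun v => 1 / fLUENorm N a *
      ((∏ l, v l ^ a) * ∏ j, ∏ k ∈ Finset.Ioi j, (v k - v j) ^ 2)) v

/-- The eigenvalue density
`ρ(x) = N ∫ p(x, y_2, …, y_N) dy_2 ⋯ dy_N` of the fixed trace Laguerre unitary ensemble with
`N = m + 2` eigenvalues; for given `x` the delta function in the PDF is `δ((1 - x) - ∑ y_l)`. -/
def fLUEDensity (m a : ℕ) (x : ℝ) : ℝ :=
  ((m + 2 : ℕ) : ℝ) *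
    ∫ y, fLUEFactor (m + 2) a (Fin.cons x y : Fin (m + 2) → ℝ) ∂(traceDelta m (1 - x))

/-- Coefficient of `f` in the differential equation. -/
def odeCoeff0 (N a x : ℝ) : ℝ :=
  x * (2 * N + a) * (N ^ 2 + a * N - 2) - a ^ 2

/-- Coefficient of `f'` in the differential equation. -/
def odeCoeff1 (N a x : ℝ) : ℝ :=
  -x * (x ^ 2 * (N ^ 2 + a * N - 4) * (N ^ 2 + a * N - 3)
    - x * (2 * N + a) * (2 * N ^ 2 + 2 * a * N - 7) + a ^ 2 - 2)

/-- Coefficient of `f''` in the differential equation. -/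
def odeCoeff2 (N a x : ℝ) : ℝ :=
  2 * x ^ 2 * (x ^ 2 * (N ^ 2 + N * a - 4) - x * (2 * N + a) + 2)

/-- Coefficient of `f'''` in the differential equation. -/
def odeCoeff3 (x : ℝ) : ℝ :=
  x ^ 3 * (1 - x ^ 2)

end

/-! On `(0,1)` the density is a polynomial, obtained from the Laguerre density by a linear map that
transports differential equations. Expanding the squared Vandermonde product over pairs of
permutations reduces the integral to Dirichlet integrals over a simplex. By homogeneity every term
has the form `x^p (1-x)^(E-p) / (E-p)!` with the same `E = N² + aN - 2`, times the factorials that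
are the moments of the Laguerre weight. So the density is a constant times `fixedTraceMap E` of a
mixed discriminant of Hankel matrices (`fLUEDensity_eq_eval`). Orthogonality of Laguerre polynomials
identifies that discriminant, up to a constant, with `X^a` times the Christoffel–Darboux kernel on
the diagonal (`mixedDiscr_laguerreHankel`). The kernel is a quadratic form in two consecutive
Laguerre polynomials, and the ladder relations give it a third order equation
(`quadratic_form_ode`). Behind `fixedTraceMap` is a Laplace transform: that of `x^p (t-x)₊^(E-p) /
(E-p)!` in `t`, taken at `s = 1`, is `x^p e^{-x}`. The map turns `weightedEuler` into `x d/dx` and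
multiplication by `x` into `x (E - x d/dx)`, which carries the Laguerre equation to the required
one. As that equation is linear and homogeneous, constants of proportionality play no role. -/

/-! ### Dirichlet integrals over the simplex. -/

theorem integral_pow_mul_sub_pow (p q : ℕ) (t : ℝ) :
    ∫ s in (0 : ℝ)..t, s ^ p * (t - s) ^ q =
      p.factorial * q.factorial / (p + q + 1).factorial * t ^ (p + q + 1) := by
  induction p generalizing q with
  | zero =>
    have h := intervalIntegral.integral_comp_sub_left (a := 0) (b := t) (fun s : ℝ => s ^ q) t
    simp only [sub_self, sub_zero, integral_pow] at h
    simp only [pow_zero, one_mul, h, zero_add, Nat.factorial_succ]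
    have : (q.factorial : ℝ) ≠ 0 := by positivity
    push_cast
    rw [div_mul_eq_mul_div, mul_comm ((q : ℝ) + 1), Nat.factorial_zero, Nat.cast_one, one_mul,
      mul_div_mul_left _ _ this]
    simp
  | succ p ih =>
    have hq : (q : ℝ) + 1 ≠ 0 := by positivity
    have hu : ∀ s ∈ Set.uIcc 0 t,
        HasDerivAt (fun s : ℝ => s ^ (p + 1)) ((p + 1 : ℝ) * s ^ p) s := fun s _ => by
      simpa using hasDerivAt_pow (p + 1) s
    -- Integration by parts moves a power from `s` to `t - s`, so `q` must vary in the induction;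
    -- both boundary terms vanish.
    have hv : ∀ s ∈ Set.uIcc 0 t,
        HasDerivAt (fun s : ℝ => -(t - s) ^ (q + 1) / (q + 1)) ((t - s) ^ q) s := fun s _ => by
      have h := ((((hasDerivAt_id s).const_sub t).pow (q + 1)).neg).div_const ((q : ℝ) + 1)
      refine h.congr_deriv ?_
      simp only [id_eq, add_tsub_cancel_right]
      push_cast
      rw [div_eq_iff hq]
      ring
    rw [intervalIntegral.integral_mul_deriv_eq_deriv_mul hu hv
      ((by fun_prop : Continuous _).intervalIntegrable _ _)
      ((by fun_prop : Continuous _).intervalIntegrable _ _)]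
    have e : ∀ s : ℝ, (p + 1 : ℝ) * s ^ p * (-(t - s) ^ (q + 1) / (q + 1)) =
        (-(p + 1 : ℝ) / (q + 1)) * (s ^ p * (t - s) ^ (q + 1)) := fun s => by ring
    simp only [e, intervalIntegral.integral_const_mul, ih]
    have h1 : p + (q + 1) + 1 = p + 1 + q + 1 := by ring
    rw [h1, Nat.factorial_succ p, Nat.factorial_succ q]
    push_cast
    have : ((p + 1 + q + 1).factorial : ℝ) ≠ 0 := by positivity
    field_simp
    simp

/-- The open positive orthant of `ℝ^k`. -/
def posOrthant (k : ℕ) : Set (Fin k → ℝ) := {v | ∀ i, 0 < v i}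

theorem measurableSet_posOrthant (k : ℕ) : MeasurableSet (posOrthant k) := by
  have : posOrthant k = Set.univ.pi fun _ => Set.Ioi 0 := by ext; simp [posOrthant]
  rw [this]
  exact MeasurableSet.univ_pi fun _ => measurableSet_Ioi

/-- Completion of `m` coordinates to a point of the hyperplane with coordinate sum `t`. -/
def simplexPoint (m : ℕ) (t : ℝ) (y : Fin m → ℝ) : Fin (m + 1) → ℝ := Fin.snoc y (t - ∑ i, y i)

theorem measurable_simplexPoint (m : ℕ) : Measurable fun q : ℝ × (Fin m → ℝ) =>
    simplexPoint m q.1 q.2 := by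
  refine measurable_pi_iff.2 fun i => ?_
  induction i using Fin.lastCases with
  | last => simp only [simplexPoint, Fin.snoc_last]; fun_prop
  | cast i => simp only [simplexPoint, Fin.snoc_castSucc]; fun_prop

theorem sum_simplexPoint (m : ℕ) (t : ℝ) (y : Fin m → ℝ) : ∑ i, simplexPoint m t y i = t := by
  simp [simplexPoint, Fin.sum_univ_castSucc]

theorem simplexPoint_cons (m : ℕ) (t s : ℝ) (y : Fin m → ℝ) :
    simplexPoint (m + 1) t (Fin.cons s y : Fin (m + 1) → ℝ) =
      (Fin.cons s (simplexPoint m (t - s) y) : Fin (m + 2) → ℝ) := by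
  simp only [simplexPoint]
  rw [Fin.cons_snoc_eq_snoc_cons, Fin.sum_univ_succ]
  simp only [Fin.cons_zero, Fin.cons_succ, sub_sub]

/-- A monomial restricted to the positive orthant. -/
noncomputable def orthantMonomial {k : ℕ} (e : Fin k → ℕ) : (Fin k → ℝ) → ℝ :=
  (posOrthant k).indicator fun v => ∏ i, v i ^ e i

theorem measurable_orthantMonomial {k : ℕ} (e : Fin k → ℕ) : Measurable (orthantMonomial e) :=
  Measurable.indicator (by fun_prop) (measurableSet_posOrthant k)

theorem orthantMonomial_nonneg {k : ℕ} (e : Fin k → ℕ) (v : Fin k → ℝ) :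
    0 ≤ orthantMonomial e v :=
  Set.indicator_apply_nonneg fun h => Finset.prod_nonneg fun i _ => pow_nonneg (h i).le _

theorem orthantMonomial_cons {k : ℕ} (e : Fin (k + 1) → ℕ) (s : ℝ) (v : Fin k → ℝ) :
    orthantMonomial e (Fin.cons s v : Fin (k + 1) → ℝ) =
      (Set.Ioi (0 : ℝ)).indicator (fun s => s ^ e 0) s * orthantMonomial (Fin.tail e) v := by
  classical
  simp only [orthantMonomial, Set.indicator_apply, posOrthant, Set.mem_ofPred_eq, Fin.forall_fin_succ,
    Fin.cons_zero, Fin.cons_succ, Fin.prod_univ_succ, Set.mem_Ioi, Fin.tail]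
  split_ifs <;> simp_all

theorem orthantMonomial_simplexPoint_of_nonpos {m : ℕ} (e : Fin (m + 1) → ℕ) {t : ℝ} (ht : t ≤ 0)
    (y : Fin m → ℝ) : orthantMonomial e (simplexPoint m t y) = 0 := by
  refine Set.indicator_of_notMem (fun h => ?_) _
  have h1 : 0 < ∑ i, simplexPoint m t y i :=
    Finset.sum_pos (fun i _ => h i) Finset.univ_nonempty
  rw [sum_simplexPoint] at h1
  linarith

/-- Dirichlet's integral of a monomial over a simplex. -/
theorem lintegral_orthantMonomial_simplexPoint (m : ℕ) (e : Fin (m + 1) → ℕ) {t : ℝ} (ht : 0 < t) :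
    ∫⁻ y, ENNReal.ofReal (orthantMonomial e (simplexPoint m t y)) =
      ENNReal.ofReal ((∏ i, ((e i).factorial : ℝ)) *
        (t ^ (∑ i, e i + m) / (∑ i, e i + m).factorial)) := by
  induction m generalizing t with
  | zero =>
    rw [Measure.volume_pi_eq_dirac, lintegral_dirac]
    have h : simplexPoint 0 t (fun a => isEmptyElim a) = fun _ => t := by
      ext i
      obtain rfl : i = Fin.last 0 := Fin.eq_zero i
      rw [simplexPoint, Fin.snoc_last]
      simp
    have : ((e 0).factorial : ℝ) ≠ 0 := by positivity
    rw [h, orthantMonomial, Set.indicator_of_mem (by intro i; exact ht)]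
    simp only [Fin.prod_univ_succ, Fin.sum_univ_succ, Finset.univ_eq_empty, Finset.prod_empty,
      Finset.sum_empty, mul_one, add_zero]
    rw [mul_div_cancel₀ _ this]
  | succ m ih =>
    have hmp := (volume_preserving_piFinSuccAbove (fun _ : Fin (m + 1) => ℝ) 0).symm
    rw [← hmp.lintegral_comp_emb (MeasurableEquiv.measurableEmbedding _), Measure.volume_eq_prod,
      lintegral_prod]
    swap
    · apply Measurable.aemeasurable
      refine ENNReal.measurable_ofReal.comp ((measurable_orthantMonomial e).comp ?_)
      exact (measurable_simplexPoint (m + 1)).comp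
        (measurable_const.prodMk (MeasurableEquiv.measurable _))
    have key : ∀ (s : ℝ) (y : Fin m → ℝ),
        (MeasurableEquiv.piFinSuccAbove (fun _ : Fin (m + 1) => ℝ) 0).symm (s, y) =
          (Fin.cons s y : Fin (m + 1) → ℝ) := fun s y => by
      ext i
      simp [MeasurableEquiv.piFinSuccAbove, Fin.insertNthEquiv]
    set q := ∑ i, Fin.tail e i + m with hq
    set K : ℝ := ∏ i, ((Fin.tail e i).factorial : ℝ) with hK
    -- With the first coordinate fixed at `s`, the others fill a simplex of size `t - s`, empty when
    -- `s ≥ t`; a Beta integral in `s` remains.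
    have inner : ∀ s : ℝ, ∫⁻ y : Fin m → ℝ, ENNReal.ofReal (orthantMonomial e (simplexPoint (m + 1) t
        ((MeasurableEquiv.piFinSuccAbove (fun _ : Fin (m + 1) => ℝ) 0).symm (s, y)))) =
        (Set.Ioo 0 t).indicator
          (fun s => ENNReal.ofReal (K / q.factorial * (s ^ e 0 * (t - s) ^ q))) s := by
      intro s
      simp only [key, simplexPoint_cons, orthantMonomial_cons]
      by_cases hs : 0 < s
      · rw [Set.indicator_of_mem (Set.mem_Ioi.2 hs)]
        by_cases hst : s < t
        · rw [Set.indicator_of_mem (Set.mem_Ioo.2 ⟨hs, hst⟩)]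
          simp only [ENNReal.ofReal_mul (pow_nonneg hs.le (e 0))]
          rw [lintegral_const_mul' _ _ ENNReal.ofReal_ne_top, ih _ (sub_pos.2 hst),
            ← ENNReal.ofReal_mul (pow_nonneg hs.le (e 0))]
          congr 1
          ring
        · rw [Set.indicator_of_notMem (fun h => hst h.2)]
          simp [orthantMonomial_simplexPoint_of_nonpos _ (sub_nonpos.2 (not_lt.1 hst))]
      · rw [Set.indicator_of_notMem (s := Set.Ioo 0 t) (fun h => hs h.1),
          Set.indicator_of_notMem (s := Set.Ioi 0) hs]
        simp
    simp only [inner]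
    rw [lintegral_indicator measurableSet_Ioo, Measure.restrict_congr_set Ioo_ae_eq_Ioc,
      ← ofReal_integral_eq_lintegral_ofReal, ← intervalIntegral.integral_of_le ht.le,
      intervalIntegral.integral_const_mul, integral_pow_mul_sub_pow]
    · congr 1
      have hs : ∑ i, e i + (m + 1) = e 0 + q + 1 := by
        rw [Fin.sum_univ_succ, hq]; simp only [Fin.tail]; ring
      have hp : ∏ i, ((e i).factorial : ℝ) = (e 0).factorial * K := by
        rw [Fin.prod_univ_succ, hK]; rfl
      rw [hs, hp]
      have : (q.factorial : ℝ) ≠ 0 := by positivity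
      field_simp
    · exact (by fun_prop : Continuous fun s : ℝ =>
        K / q.factorial * (s ^ e 0 * (t - s) ^ q)).integrableOn_Ioc
    · refine (ae_restrict_iff' measurableSet_Ioc).2 (Filter.Eventually.of_forall fun s hs => ?_)
      have := sub_nonneg.2 hs.2
      have := hs.1.le
      simp only [Pi.zero_apply]
      positivity

/-- The integrand is nonnegative, so the finite lower integral yields integrability and the value at
once. -/
theorem hasIntegral_orthantMonomial_traceDelta (m : ℕ) (e : Fin (m + 1) → ℕ) {t : ℝ} (ht : 0 < t) :
    Integrable (orthantMonomial e) (traceDelta m t) ∧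
      ∫ v, orthantMonomial e v ∂(traceDelta m t) = (∏ i, ((e i).factorial : ℝ)) *
        (t ^ (∑ i, e i + m) / (∑ i, e i + m).factorial) := by
  have hm : Measurable (simplexPoint m t) :=
    (measurable_simplexPoint m).comp (measurable_const.prodMk measurable_id)
  have hE := measurable_orthantMonomial e
  have hl : ∫⁻ v, ENNReal.ofReal (orthantMonomial e v) ∂(traceDelta m t) = _ :=
    (lintegral_map hE.ennreal_ofReal hm).trans (lintegral_orthantMonomial_simplexPoint m e ht)
  have hpos := Filter.Eventually.of_forall (f := ae (traceDelta m t)) (orthantMonomial_nonneg e)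
  refine ⟨⟨hE.aestronglyMeasurable, ?_⟩, ?_⟩
  · rw [hasFiniteIntegral_iff_ofReal hpos, hl]
    exact ENNReal.ofReal_lt_top
  · rw [integral_eq_lintegral_of_nonneg_ae hpos hE.aestronglyMeasurable, hl,
      ENNReal.toReal_ofReal (by positivity)]

/-! ### The density as the image of a mixed discriminant. -/

open Polynomial in
/-- The polynomial `x^p (1-x)^(E-p) / (E-p)!`, vanishing for `p > E`. -/
noncomputable def simplexTerm (E p : ℕ) : ℝ[X] :=
  if p ≤ E then C (1 / ((E - p).factorial : ℝ)) * (X ^ p * (1 - X) ^ (E - p)) else 0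

open Polynomial in
/-- The linear map `x^p ↦ x^p (1-x)^(E-p) / (E-p)!` that carries the Laguerre ensemble to its fixed
trace version. -/
noncomputable def fixedTraceMap (E : ℕ) : ℝ[X] →ₗ[ℝ] ℝ[X] :=
  (basisMonomials ℝ).constr ℝ (simplexTerm E)

open Polynomial in
theorem fixedTraceMap_X_pow (E p : ℕ) : fixedTraceMap E (X ^ p) = simplexTerm E p := by
  rw [fixedTraceMap, X_pow_eq_monomial]
  have := (basisMonomials ℝ).constr_basis ℝ (simplexTerm E) p
  rwa [coe_basisMonomials] at this

/-- The mixed discriminant (up to normalisation) of a family of matrices. -/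
noncomputable def mixedDiscr {R : Type*} [CommRing R] {n : ℕ}
    (W : Fin n → Matrix (Fin n) (Fin n) R) : R :=
  ∑ σ : Equiv.Perm (Fin n), ∑ τ : Equiv.Perm (Fin n),
    ((Equiv.Perm.sign σ : ℤ) : R) * ((Equiv.Perm.sign τ : ℤ) : R) * ∏ i, W i (σ i) (τ i)

open Polynomial in
/-- Hankel matrices: the powers of `X` for the first variable, the moments of the Laguerre weight
for the others. -/
noncomputable def laguerreHankel (n a : ℕ) : Fin (n + 1) → Matrix (Fin (n + 1)) (Fin (n + 1)) ℝ[X] :=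
  Fin.cons (Matrix.of fun j k => X ^ (a + j + k))
    fun _ => Matrix.of fun j k => C (((a + j + k : ℕ).factorial : ℝ))

theorem prod_sub_sq_eq_sum_perm {R : Type*} [CommRing R] {n : ℕ} (v : Fin n → R) :
    ∏ j, ∏ k ∈ Finset.Ioi j, (v k - v j) ^ 2 =
      ∑ σ : Equiv.Perm (Fin n), ∑ τ : Equiv.Perm (Fin n),
        ((Equiv.Perm.sign σ : ℤ) : R) * ((Equiv.Perm.sign τ : ℤ) : R) *
          ∏ i, v i ^ ((σ i : ℕ) + τ i) := by
  have h : (Matrix.vandermonde v).det =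
      ∑ σ : Equiv.Perm (Fin n), ((Equiv.Perm.sign σ : ℤ) : R) * ∏ i, v i ^ (σ i : ℕ) := by
    rw [← Matrix.det_transpose, Matrix.det_apply']
    simp [Matrix.vandermonde_apply]
  simp only [Finset.prod_pow, ← Matrix.det_vandermonde]
  rw [h, sq, Finset.sum_mul_sum]
  refine Finset.sum_congr rfl fun σ _ => Finset.sum_congr rfl fun τ _ => ?_
  simp only [pow_add, Finset.prod_mul_distrib]
  ring

theorem ae_sum_traceDelta (m : ℕ) (t : ℝ) : ∀ᵐ v ∂(traceDelta m t), ∑ i, v i = t := by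
  have hm : Measurable (simplexPoint m t) :=
    (measurable_simplexPoint m).comp (measurable_const.prodMk measurable_id)
  refine (ae_map_iff hm.aemeasurable ?_).2 (Filter.Eventually.of_forall fun y =>
    sum_simplexPoint m t y)
  exact measurableSet_eq_fun (by fun_prop) measurable_const

/-- Positive coordinates with sum `1 - x < 1` are each below `1`, so on the hyperplane the cube can
be replaced by the orthant. -/
theorem fLUEFactor_cons_ae (m a : ℕ) {x : ℝ} (hx : x ∈ Set.Ioo (0 : ℝ) 1) :
    (fun v : Fin (m + 1) → ℝ => fLUEFactor (m + 2) a (Fin.cons x v : Fin (m + 2) → ℝ))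
      =ᵐ[traceDelta m (1 - x)]
    fun v => ∑ σ : Equiv.Perm (Fin (m + 2)), ∑ τ : Equiv.Perm (Fin (m + 2)),
      (1 / fLUENorm (m + 2) a * (((Equiv.Perm.sign σ : ℤ) : ℝ) * ((Equiv.Perm.sign τ : ℤ) : ℝ)) *
        x ^ (a + (σ 0 : ℕ) + τ 0)) *
        orthantMonomial (fun i : Fin (m + 1) => a + (σ i.succ : ℕ) + τ i.succ) v := by
  filter_upwards [ae_sum_traceDelta m (1 - x)] with v hv
  by_cases hpos : v ∈ posOrthant (m + 1)
  · have hmem : (Fin.cons x v : Fin (m + 2) → ℝ) ∈ Set.univ.pi fun _ => Set.Ioo (0 : ℝ) 1 := by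
      intro i _
      induction i using Fin.cases with
      | zero => exact hx
      | succ i =>
        refine ⟨hpos i, ?_⟩
        have := Finset.single_le_sum (f := v) (fun j _ => (hpos j).le) (Finset.mem_univ i)
        rw [Fin.cons_succ]
        linarith [hx.1]
    simp only [fLUEFactor, orthantMonomial]
    rw [Set.indicator_of_mem hmem]
    simp only [Set.indicator_of_mem hpos]
    rw [prod_sub_sq_eq_sum_perm, Finset.mul_sum, Finset.mul_sum]
    refine Finset.sum_congr rfl fun σ _ => ?_
    rw [Finset.mul_sum, Finset.mul_sum]
    refine Finset.sum_congr rfl fun τ _ => ?_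
    simp only [Fin.prod_univ_succ, Fin.cons_zero, Fin.cons_succ, pow_add, Finset.prod_mul_distrib]
    ring
  · have hmem : (Fin.cons x v : Fin (m + 2) → ℝ) ∉ Set.univ.pi fun _ => Set.Ioo (0 : ℝ) 1 :=
      fun h => hpos fun i => by simpa using (h i.succ (Set.mem_univ _)).1
    simp only [fLUEFactor, orthantMonomial]
    rw [Set.indicator_of_notMem hmem]
    simp [Set.indicator_of_notMem hpos]

theorem integrable_fLUEFactor_cons (m a : ℕ) {x : ℝ} (hx : x ∈ Set.Ioo (0 : ℝ) 1) :
    Integrable (fun v : Fin (m + 1) → ℝ => fLUEFactor (m + 2) a (Fin.cons x v : Fin (m + 2) → ℝ))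
      (traceDelta m (1 - x)) := by
  rw [integrable_congr (fLUEFactor_cons_ae m a hx)]
  refine integrable_finsetSum _ fun σ _ => integrable_finsetSum _ fun τ _ => ?_
  exact (hasIntegral_orthantMonomial_traceDelta m _ (sub_pos.2 hx.2)).1.const_mul _

/-- The exponent `N² + aN - 2` with `N = m + 2`. -/
def fLUEDegree (m a : ℕ) : ℕ := (m + 2) * a + (m + 2) * (m + 1) + m

theorem sum_perm_val {n : ℕ} (σ : Equiv.Perm (Fin (n + 1))) : 2 * ∑ i, (σ i : ℕ) = (n + 1) * n := by
  rw [Equiv.sum_comp σ (fun i : Fin (n + 1) => (i : ℕ)), Fin.sum_univ_eq_sum_range (fun i => i),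
    mul_comm, Finset.sum_range_id_mul_two, Nat.add_sub_cancel]

theorem fLUEDensity_eq_eval (m a : ℕ) {x : ℝ} (hx : x ∈ Set.Ioo (0 : ℝ) 1) :
    fLUEDensity m a x = ((m + 2 : ℕ) : ℝ) * (1 / fLUENorm (m + 2) a) *
      (fixedTraceMap (fLUEDegree m a) (mixedDiscr (laguerreHankel (m + 1) a))).eval x := by
  have hI := fun e => hasIntegral_orthantMonomial_traceDelta m e (sub_pos.2 hx.2)
  rw [fLUEDensity, integral_congr_ae (fLUEFactor_cons_ae m a hx), mul_assoc]
  congr 1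
  rw [integral_finsetSum _ fun σ _ => integrable_finsetSum _ fun τ _ => (hI _).1.const_mul _,
    mixedDiscr, map_sum, Polynomial.eval_finsetSum, Finset.mul_sum]
  refine Finset.sum_congr rfl fun σ _ => ?_
  rw [integral_finsetSum _ fun τ _ => (hI _).1.const_mul _, map_sum, Polynomial.eval_finsetSum,
    Finset.mul_sum]
  refine Finset.sum_congr rfl fun τ _ => ?_
  rw [integral_const_mul, (hI _).2]
  -- Homogeneity: the total degree does not depend on `σ` and `τ`, so one `E` serves all terms.
  have hE : a + (σ 0 : ℕ) + τ 0 + (∑ i : Fin (m + 1), (a + (σ i.succ : ℕ) + τ i.succ) + m) =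
      fLUEDegree m a := by
    have h1 := sum_perm_val σ
    have h2 := sum_perm_val τ
    rw [Fin.sum_univ_succ] at h1 h2
    simp only [Finset.sum_add_distrib, Finset.sum_const, Finset.card_univ, Fintype.card_fin,
      smul_eq_mul, fLUEDegree]
    linarith
  set q := ∑ i : Fin (m + 1), (a + (σ i.succ : ℕ) + τ i.succ) + m
  have hpoly : (((Equiv.Perm.sign σ : ℤ) : Polynomial ℝ) * ((Equiv.Perm.sign τ : ℤ) : Polynomial ℝ) *
      ∏ i : Fin (m + 1 + 1), laguerreHankel (m + 1) a i (σ i) (τ i)) =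
      ((((Equiv.Perm.sign σ : ℤ) : ℝ) * ((Equiv.Perm.sign τ : ℤ) : ℝ)) *
        ∏ i : Fin (m + 1), ((a + (σ i.succ : ℕ) + τ i.succ).factorial : ℝ)) •
        (Polynomial.X ^ (a + (σ 0 : ℕ) + τ 0)) := by
    rw [Fin.prod_univ_succ]
    simp only [laguerreHankel, Fin.cons_zero, Fin.cons_succ, Matrix.of_apply, Polynomial.smul_eq_C_mul,
      map_mul, map_prod, map_intCast]
    ring
  erw [hpoly]
  rw [map_smul, fixedTraceMap_X_pow, simplexTerm, if_pos (by omega), Polynomial.eval_smul]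
  rw [show fLUEDegree m a - (a + (σ 0 : ℕ) + τ 0) = q by omega]
  simp only [Polynomial.eval_mul, Polynomial.eval_C, Polynomial.eval_pow, Polynomial.eval_X,
    Polynomial.eval_sub, Polynomial.eval_one, smul_eq_mul]
  ring

/-! ### Algebra of mixed discriminants. -/

theorem mixedDiscr_eq_sum_det {R : Type*} [CommRing R] {n : ℕ}
    (W : Fin n → Matrix (Fin n) (Fin n) R) :
    mixedDiscr W = ∑ τ : Equiv.Perm (Fin n), ((Equiv.Perm.sign τ : ℤ) : R) *
      (Matrix.of fun k i => W i k (τ i)).det := by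
  rw [mixedDiscr, Finset.sum_comm]
  refine Finset.sum_congr rfl fun τ _ => ?_
  rw [Matrix.det_apply', Finset.mul_sum]
  refine Finset.sum_congr rfl fun σ _ => ?_
  simp only [Matrix.of_apply]
  ring

/-- For fixed `τ` the sum over `σ` is a determinant with one column from each `W i`, and `A` acts on
all the columns at once. -/
theorem mixedDiscr_mul_left {R : Type*} [CommRing R] {n : ℕ} (A : Matrix (Fin n) (Fin n) R)
    (W : Fin n → Matrix (Fin n) (Fin n) R) :
    mixedDiscr (fun i => A * W i) = A.det * mixedDiscr W := by
  rw [mixedDiscr_eq_sum_det, mixedDiscr_eq_sum_det, Finset.mul_sum]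
  refine Finset.sum_congr rfl fun τ _ => ?_
  have : (Matrix.of fun k i => (A * W i) k (τ i)) = A * Matrix.of fun k i => W i k (τ i) := by
    ext k i
    simp [Matrix.mul_apply]
  rw [this, Matrix.det_mul]
  ring

theorem mixedDiscr_transpose {R : Type*} [CommRing R] {n : ℕ}
    (W : Fin n → Matrix (Fin n) (Fin n) R) :
    mixedDiscr (fun i => (W i).transpose) = mixedDiscr W := by
  rw [mixedDiscr, Finset.sum_comm]
  refine Finset.sum_congr rfl fun σ _ => Finset.sum_congr rfl fun τ _ => ?_
  simp only [Matrix.transpose_apply]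
  ring

theorem mixedDiscr_congruence {R : Type*} [CommRing R] {n : ℕ} (A : Matrix (Fin n) (Fin n) R)
    (W : Fin n → Matrix (Fin n) (Fin n) R) :
    mixedDiscr (fun i => A * W i * A.transpose) = A.det ^ 2 * mixedDiscr W := by
  have h : (fun i => A * W i * A.transpose) = fun i => (A * (A * W i).transpose).transpose := by
    ext1 i
    rw [Matrix.transpose_mul, Matrix.transpose_transpose]
  rw [h, mixedDiscr_transpose (fun i => A * (A * W i).transpose),
    mixedDiscr_mul_left A (fun i => (A * W i).transpose), mixedDiscr_transpose, mixedDiscr_mul_left]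
  ring

theorem sum_perm_apply_zero {R : Type*} [CommRing R] {n : ℕ} (F : Fin (n + 1) → R) :
    ∑ σ : Equiv.Perm (Fin (n + 1)), F (σ 0) = n.factorial * ∑ k, F k := by
  rw [← Equiv.sum_comp Equiv.Perm.decomposeFin.symm, Fintype.sum_prod_type, Finset.mul_sum]
  refine Finset.sum_congr rfl fun k _ => ?_
  simp [Equiv.Perm.decomposeFin_symm_apply_zero, Fintype.card_perm]

/-- Diagonality forces `σ` and `τ` to agree at every successor index, hence also at `0`, so only `σ
= τ` contributes. The inverse `g` of `h` expresses the product with one factor removed without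
division in `R`. -/
theorem mixedDiscr_rankOne_diagonal {R : Type*} [CommRing R] {n : ℕ} (c : R)
    (u h g : Fin (n + 1) → R) (hg : ∀ k, h k * g k = 1) :
    mixedDiscr (Fin.cons (Matrix.of fun j k => c * (u j * u k)) fun _ => Matrix.diagonal h :
      Fin (n + 1) → Matrix (Fin (n + 1)) (Fin (n + 1)) R) =
      (∏ k, h k) * n.factorial * (c * ∑ k, g k * u k ^ 2) := by
  have hσ : ∀ σ : Equiv.Perm (Fin (n + 1)), ∑ τ : Equiv.Perm (Fin (n + 1)),
      ((Equiv.Perm.sign σ : ℤ) : R) * ((Equiv.Perm.sign τ : ℤ) : R) *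
        ∏ i, (Fin.cons (Matrix.of fun j k => c * (u j * u k)) fun _ => Matrix.diagonal h :
          Fin (n + 1) → Matrix (Fin (n + 1)) (Fin (n + 1)) R) i (σ i) (τ i) =
      (∏ k, h k) * (c * (g (σ 0) * u (σ 0) ^ 2)) := by
    intro σ
    rw [Finset.sum_eq_single σ]
    · have h1 : ((Equiv.Perm.sign σ : ℤ) : R) * ((Equiv.Perm.sign σ : ℤ) : R) = 1 := by
        rcases Int.units_eq_one_or (Equiv.Perm.sign σ) with h | h <;> simp [h]
      rw [← Equiv.prod_comp σ h, h1, Fin.prod_univ_succ, Fin.prod_univ_succ]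
      simp only [Fin.cons_zero, Fin.cons_succ, Matrix.of_apply, Matrix.diagonal_apply_eq]
      linear_combination (-(∏ i : Fin n, h (σ i.succ)) * (c * u (σ 0) ^ 2)) * hg (σ 0)
    · intro τ _ hne
      have : ∃ i : Fin n, σ i.succ ≠ τ i.succ := by
        by_contra! hall
        have h0 : τ 0 = σ 0 := by
          obtain ⟨j, hj⟩ := σ.surjective (τ 0)
          induction j using Fin.cases with
          | zero => exact hj.symm
          | succ j =>
            rw [hall j] at hj
            exact absurd (τ.injective hj) (Fin.succ_ne_zero j)
        refine hne (Equiv.ext fun i => ?_)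
        induction i using Fin.cases with
        | zero => exact h0
        | succ i => exact (hall i).symm
      obtain ⟨i, hi⟩ := this
      rw [Finset.prod_eq_zero (Finset.mem_univ i.succ), mul_zero]
      rw [Fin.cons_succ, Matrix.diagonal_apply_ne _ hi]
    · simp
  rw [mixedDiscr, Finset.sum_congr rfl fun σ _ => hσ σ,
    sum_perm_apply_zero fun k => (∏ k, h k) * (c * (g k * u k ^ 2))]
  simp only [Finset.mul_sum]
  exact Finset.sum_congr rfl fun k _ => by ring

/-! ### Orthogonality of Laguerre polynomials and the Christoffel–Darboux kernel. -/

/-- Coefficients of the normalised Laguerre polynomials. -/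
noncomputable def laguerreCoeff (a n i : ℕ) : ℝ := (-1) ^ i * n.choose i / ((a + i).factorial : ℝ)

open Polynomial in
/-- The Laguerre polynomial `n! / (n+a)! · L_n^{(a)}`. -/
noncomputable def laguerrePoly (a n : ℕ) : ℝ[X] :=
  ∑ i ∈ Finset.range (n + 1), C (laguerreCoeff a n i) * X ^ i

theorem laguerreCoeff_of_lt {a n i : ℕ} (h : n < i) : laguerreCoeff a n i = 0 := by
  simp [laguerreCoeff, Nat.choose_eq_zero_of_lt h]

open Polynomial in
theorem coeff_laguerrePoly (a n i : ℕ) : (laguerrePoly a n).coeff i = laguerreCoeff a n i := by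
  simp only [laguerrePoly, finsetSum_coeff, coeff_C_mul_X_pow]
  rw [Finset.sum_ite_eq]
  split_ifs with h
  · rfl
  · rw [laguerreCoeff_of_lt]
    simpa [Nat.lt_succ_iff] using h

open Polynomial in
theorem sum_fin_laguerreCoeff {a n k : ℕ} (h : k ≤ n) :
    ∑ i : Fin (n + 1), C (laguerreCoeff a k i) * X ^ (i : ℕ) = laguerrePoly a k := by
  rw [Fin.sum_univ_eq_sum_range (fun i => C (laguerreCoeff a k i) * X ^ i), laguerrePoly]
  symm
  refine Finset.sum_subset (fun i => by simp only [Finset.mem_range]; omega) fun i _ hi => ?_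
  rw [laguerreCoeff_of_lt (by simpa [Nat.lt_succ_iff] using hi)]
  simp

/-- Moments of the normalised Laguerre polynomials, as iterated forward differences. -/
theorem sum_laguerreCoeff_mul_factorial (a k j : ℕ) :
    ∑ i ∈ Finset.range (k + 1), laguerreCoeff a k i * ((a + i + j).factorial : ℝ) =
      (-1) ^ k * (fwdDiff 1)^[k]
        (fun y : ℝ => ((ascPochhammer ℝ j).comp (Polynomial.X + Polynomial.C (a + 1 : ℝ))).eval y)
        0 := by
  rw [fwdDiff_iter_eq_sum_shift, Finset.mul_sum]
  refine Finset.sum_congr rfl fun i hi => ?_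
  have hik : i ≤ k := Nat.lt_succ_iff.1 (Finset.mem_range.1 hi)
  -- The ratio `(a+i+j)! / (a+i)!` is a monic polynomial of degree `j` in `i`; its `k`-th difference
  -- is `0` for `j < k` and `k!` for `j = k`.
  have h1 : (ascPochhammer ℝ j).eval ((i : ℝ) + (a + 1)) * ((a + i).factorial : ℝ) =
      ((a + i + j).factorial : ℝ) := by
    have := Nat.factorial_mul_ascFactorial (a + i) j
    rw [← this, Nat.cast_mul, Nat.cast_ascFactorial, mul_comm]
    congr 2
    push_cast
    ring
  obtain ⟨d, rfl⟩ := Nat.exists_eq_add_of_le hik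
  have h2 : ((a + i).factorial : ℝ) ≠ 0 := by positivity
  have h3 : ((-1 : ℝ)) ^ d * (-1) ^ d = 1 := by rw [← mul_pow]; simp
  simp only [Polynomial.eval_comp, Polynomial.eval_add, Polynomial.eval_X, Polynomial.eval_C,
    zero_add, nsmul_eq_mul, mul_one, zsmul_eq_mul]
  rw [← h1, laguerreCoeff, Nat.add_sub_cancel_left, div_mul_eq_mul_div, div_eq_iff h2]
  push_cast
  rw [pow_add]
  linear_combination (-(-1 : ℝ) ^ i * ((i + d).choose i : ℝ) *
    (ascPochhammer ℝ j).eval ((i : ℝ) + (a + 1)) * ((a + i).factorial : ℝ)) * h3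

theorem sum_laguerreCoeff_mul_factorial_of_lt (a : ℕ) {k j : ℕ} (h : j < k) :
    ∑ i ∈ Finset.range (k + 1), laguerreCoeff a k i * ((a + i + j).factorial : ℝ) = 0 := by
  rw [sum_laguerreCoeff_mul_factorial]
  have hd : ((ascPochhammer ℝ j).comp (Polynomial.X + Polynomial.C (a + 1 : ℝ))).natDegree < k := by
    rw [Polynomial.natDegree_comp, ascPochhammer_natDegree, Polynomial.natDegree_X_add_C, mul_one]
    exact h
  have := congrFun (Polynomial.fwdDiff_iter_eq_zero_of_degree_lt hd) 0
  simp only [this, Pi.zero_apply, mul_zero]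

theorem sum_laguerreCoeff_mul_factorial_self (a k : ℕ) :
    ∑ i ∈ Finset.range (k + 1), laguerreCoeff a k i * ((a + i + k).factorial : ℝ) =
      (-1) ^ k * k.factorial := by
  rw [sum_laguerreCoeff_mul_factorial]
  have hm : ((ascPochhammer ℝ k).comp (Polynomial.X + Polynomial.C (a + 1 : ℝ))).Monic :=
    (monic_ascPochhammer ℝ k).comp_X_add_C _
  have hd : ((ascPochhammer ℝ k).comp (Polynomial.X + Polynomial.C (a + 1 : ℝ))).natDegree = k := by
    rw [Polynomial.natDegree_comp, ascPochhammer_natDegree, Polynomial.natDegree_X_add_C, mul_one]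
  have := congrFun (Polynomial.fwdDiff_iter_degree_eq_factorial
    ((ascPochhammer ℝ k).comp (Polynomial.X + Polynomial.C (a + 1 : ℝ)))) 0
  rw [hd, hm.leadingCoeff] at this
  rw [this]
  simp

/-- The lower triangular matrix of coefficients of the normalised Laguerre polynomials. -/
noncomputable def laguerreMatrix (n a : ℕ) : Matrix (Fin (n + 1)) (Fin (n + 1)) ℝ :=
  Matrix.of fun k i => laguerreCoeff a k i

theorem det_laguerreMatrix_ne_zero (n a : ℕ) : (laguerreMatrix n a).det ≠ 0 := by
  have h : (laguerreMatrix n a).IsLowerTriangular := fun i j hij =>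
    laguerreCoeff_of_lt (Fin.lt_def.1 (OrderDual.toDual_lt_toDual.1 hij))
  rw [Matrix.det_of_isLowerTriangular _ h]
  refine Finset.prod_ne_zero_iff.2 fun i _ => ?_
  simp only [laguerreMatrix, Matrix.of_apply, laguerreCoeff, Nat.choose_self]
  positivity

theorem laguerreMatrix_mul_moments (n a : ℕ) (k j : Fin (n + 1)) :
    (laguerreMatrix n a * Matrix.of fun i j : Fin (n + 1) => ((a + i + j : ℕ).factorial : ℝ)) k j =
      ∑ i ∈ Finset.range (k + 1), laguerreCoeff a k i * ((a + i + j).factorial : ℝ) := by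
  simp only [Matrix.mul_apply, laguerreMatrix, Matrix.of_apply]
  rw [Fin.sum_univ_eq_sum_range
    (fun i => laguerreCoeff a k i * ((a + i + j : ℕ).factorial : ℝ)) (n + 1)]
  symm
  refine Finset.sum_subset (fun i => by simp only [Finset.mem_range]; omega) fun i _ hi => ?_
  rw [laguerreCoeff_of_lt (by simpa [Nat.lt_succ_iff] using hi), zero_mul]

theorem laguerreMatrix_orthogonal (n a : ℕ) :
    laguerreMatrix n a * (Matrix.of fun i j : Fin (n + 1) => ((a + i + j : ℕ).factorial : ℝ)) *
      (laguerreMatrix n a).transpose =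
      Matrix.diagonal fun k : Fin (n + 1) => ((k : ℕ).factorial : ℝ) / ((a + k).factorial : ℝ) := by
  set M : Matrix (Fin (n + 1)) (Fin (n + 1)) ℝ :=
    Matrix.of fun i j : Fin (n + 1) => ((a + i + j : ℕ).factorial : ℝ) with hM
  set A := laguerreMatrix n a with hA
  have hMt : M.transpose = M := by
    ext i j
    simp only [hM, Matrix.transpose_apply, Matrix.of_apply, add_right_comm]
  have hsymm : (A * M * A.transpose).transpose = A * M * A.transpose := by
    rw [Matrix.transpose_mul, Matrix.transpose_mul, Matrix.transpose_transpose, hMt,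
      Matrix.mul_assoc]
  have hsum : ∀ j k, (A * M * A.transpose) j k = ∑ i, (A * M) j i * laguerreCoeff a k i := by
    intro j k
    rw [Matrix.mul_apply]
    rfl
  -- In row `j` of `A * M` the entries left of the diagonal vanish, and row `k` of `A` stops at
  -- column `k < j`. Symmetry then handles the entries above the diagonal.
  have hlt : ∀ j k, k < j → (A * M * A.transpose) j k = 0 := by
    intro j k hkj
    rw [hsum]
    refine Finset.sum_eq_zero fun i _ => ?_
    by_cases hi : i < j
    · rw [laguerreMatrix_mul_moments, sum_laguerreCoeff_mul_factorial_of_lt a hi, zero_mul]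
    · rw [laguerreCoeff_of_lt (lt_of_lt_of_le hkj (not_lt.1 hi)), mul_zero]
  ext j k
  rcases lt_trichotomy j k with h | rfl | h
  · rw [← hsymm, Matrix.transpose_apply, hlt _ _ h, Matrix.diagonal_apply_ne _ h.ne]
  · rw [hsum, Finset.sum_eq_single j, laguerreMatrix_mul_moments,
      sum_laguerreCoeff_mul_factorial_self, laguerreCoeff, Nat.choose_self,
      Matrix.diagonal_apply_eq]
    · have : ((-1 : ℝ)) ^ (j : ℕ) * (-1) ^ (j : ℕ) = 1 := by rw [← mul_pow]; simp
      push_cast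
      linear_combination (((j : ℕ).factorial : ℝ) / ((a + j).factorial : ℝ)) * this
    · intro i _ hi
      rcases lt_or_gt_of_ne hi with hi | hi
      · rw [laguerreMatrix_mul_moments, sum_laguerreCoeff_mul_factorial_of_lt a hi, zero_mul]
      · rw [laguerreCoeff_of_lt hi, mul_zero]
    · simp
  · rw [hlt _ _ h, Matrix.diagonal_apply_ne _ h.ne']

open Polynomial in
/-- The Christoffel–Darboux kernel of the Laguerre polynomials on the diagonal. -/
noncomputable def laguerreKernel (a n : ℕ) : ℝ[X] :=
  ∑ k ∈ Finset.range n, C (((a + k).factorial : ℝ) / (k.factorial : ℝ)) * laguerrePoly a k ^ 2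

open Polynomial in
-- Congruence by the coefficient matrix makes the moment matrices diagonal and the matrix of powers
-- rank one, while multiplying the discriminant by a nonzero constant.
theorem mixedDiscr_laguerreHankel (n a : ℕ) :
    ∃ c : ℝ, mixedDiscr (laguerreHankel n a) = c • (X ^ a * laguerreKernel a (n + 1)) := by
  set A := (laguerreMatrix n a).map (C : ℝ → ℝ[X]) with hA
  have h1 : ∀ i, A * laguerreHankel n a i * A.transpose =
      (Fin.cons (Matrix.of fun j k : Fin (n + 1) => X ^ a * (laguerrePoly a j * laguerrePoly a k))
        fun _ => Matrix.diagonal fun k : Fin (n + 1) =>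
          C (((k : ℕ).factorial : ℝ) / ((a + k).factorial : ℝ)) :
        Fin (n + 1) → Matrix (Fin (n + 1)) (Fin (n + 1)) ℝ[X]) i := by
    intro i
    induction i using Fin.cases with
    | zero =>
      ext1 j k
      simp only [laguerreHankel, Fin.cons_zero, Matrix.mul_apply, Matrix.of_apply,
        Matrix.transpose_apply, hA, Matrix.map_apply, laguerreMatrix]
      rw [← sum_fin_laguerreCoeff (Nat.lt_succ_iff.1 j.2),
        ← sum_fin_laguerreCoeff (Nat.lt_succ_iff.1 k.2), Finset.sum_mul_sum, Finset.mul_sum,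
        Finset.sum_congr rfl fun i _ => Finset.sum_mul _ _ _, Finset.sum_comm]
      refine Finset.sum_congr rfl fun i _ => ?_
      rw [Finset.mul_sum]
      refine Finset.sum_congr rfl fun l _ => ?_
      rw [pow_add, pow_add]
      ring
    | succ i =>
      have := congrArg (fun M : Matrix (Fin (n + 1)) (Fin (n + 1)) ℝ => M.map (C : ℝ →+* ℝ[X]))
        (laguerreMatrix_orthogonal n a)
      simp only [Matrix.map_mul] at this
      rw [Matrix.diagonal_map (map_zero _)] at this
      exact this
  have h2 := mixedDiscr_congruence A (laguerreHankel n a)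
  rw [funext h1, mixedDiscr_rankOne_diagonal (X ^ a) (fun k : Fin (n + 1) => laguerrePoly a k) _
    (fun k : Fin (n + 1) => C (((a + k).factorial : ℝ) / ((k : ℕ).factorial : ℝ)))] at h2
  · have hd : A.det = C (laguerreMatrix n a).det := (RingHom.map_det C _).symm
    have h0 := det_laguerreMatrix_ne_zero n a
    rw [Fin.sum_univ_eq_sum_range (fun k => C (((a + k).factorial : ℝ) / ((k : ℕ).factorial : ℝ)) *
      laguerrePoly a k ^ 2), ← laguerreKernel, hd] at h2
    refine ⟨((laguerreMatrix n a).det ^ 2)⁻¹ * ((∏ k : Fin (n + 1),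
      ((k : ℕ).factorial : ℝ) / ((a + k).factorial : ℝ)) * n.factorial), ?_⟩
    have h3 : (C ((laguerreMatrix n a).det ^ 2)⁻¹ * C (laguerreMatrix n a).det ^ 2 : ℝ[X]) = 1 := by
      rw [← C_pow, ← C_mul, inv_mul_cancel₀ (pow_ne_zero 2 h0), C_1]
    rw [smul_eq_C_mul, C_mul, C_mul, map_prod, C_eq_natCast]
    linear_combination (-mixedDiscr (laguerreHankel n a)) * h3 - C ((laguerreMatrix n a).det ^ 2)⁻¹ * h2
  · intro k
    rw [← C_mul]
    have : ((k : ℕ).factorial : ℝ) ≠ 0 := by positivity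
    have : ((a + k : ℕ).factorial : ℝ) ≠ 0 := by positivity
    rw [div_mul_div_cancel₀ this, div_self ‹_›, C_1]

/-! ### Ladder relations and the closed form of the kernel. -/

section

open Polynomial

theorem X_mul_derivative_laguerrePoly_succ (a n : ℕ) :
    X * derivative (laguerrePoly a (n + 1)) =
      C ((n : ℝ) + 1) * (laguerrePoly a (n + 1) - laguerrePoly a n) := by
  ext i
  rcases i with _ | i
  · simp [coeff_laguerrePoly, laguerreCoeff]
  · rw [coeff_X_mul, coeff_derivative, coeff_C_mul, coeff_sub]
    simp only [coeff_laguerrePoly, laguerreCoeff]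
    have h : ((n + 1).choose (i + 1) : ℝ) = n.choose i + n.choose (i + 1) := by
      exact_mod_cast Nat.choose_succ_succ n i
    have h2 : ((n : ℝ) + 1) * n.choose i = (n + 1).choose (i + 1) * (i + 1) := by
      exact_mod_cast Nat.add_one_mul_choose_eq n i
    have : ((a + (i + 1)).factorial : ℝ) ≠ 0 := by positivity
    field_simp
    linear_combination -h2 - ((n : ℝ) + 1) * h

theorem X_mul_derivative_laguerrePoly (a n : ℕ) :
    X * derivative (laguerrePoly a n) =
      C ((n : ℝ) + 1 + a) * laguerrePoly a (n + 1) -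
        (C ((n : ℝ) + 1 + a) - X) * laguerrePoly a n := by
  rw [sub_mul]
  ext i
  rcases i with _ | i
  · simp only [mul_coeff_zero, coeff_sub, coeff_X_zero, coeff_C_zero]
    simp [coeff_laguerrePoly, laguerreCoeff]
  · rw [coeff_sub, coeff_sub, coeff_X_mul, coeff_X_mul, coeff_derivative, coeff_C_mul, coeff_C_mul]
    simp only [coeff_laguerrePoly, laguerreCoeff]
    have h : ((n + 1).choose (i + 1) : ℝ) = n.choose i + n.choose (i + 1) := by
      exact_mod_cast Nat.choose_succ_succ n i
    have h2 : ((n : ℝ) + 1) * n.choose i = (n + 1).choose (i + 1) * (i + 1) := by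
      exact_mod_cast Nat.add_one_mul_choose_eq n i
    have hf : ((a + (i + 1)).factorial : ℝ) = (a + i + 1) * (a + i).factorial := by
      rw [← add_assoc, Nat.factorial_succ]; push_cast; ring
    have : ((a + i).factorial : ℝ) ≠ 0 := by positivity
    have : ((a : ℝ) + i + 1) ≠ 0 := by positivity
    rw [hf, pow_succ]
    field_simp
    linear_combination h2 + ((n : ℝ) + a + i + 2) * h

/-- The raising and lowering relations give two expressions for the same derivative. -/
theorem laguerrePoly_recurrence (a n : ℕ) :
    C ((n : ℝ) + 2 + a) * laguerrePoly a (n + 2) =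
      (C (2 * (n : ℝ) + 3 + a) - X) * laguerrePoly a (n + 1) - C ((n : ℝ) + 1) * laguerrePoly a n := by
  have h1 := X_mul_derivative_laguerrePoly_succ a n
  have h2 := X_mul_derivative_laguerrePoly a (n + 1)
  push_cast at h2
  simp only [map_add, map_mul, map_natCast, map_one, map_ofNat] at h1 h2 ⊢
  linear_combination h1 - h2

/-- Confluent Christoffel–Darboux formula with the derivatives eliminated by the ladder relations;
in the induction the increment is absorbed by the three-term recurrence. -/
theorem X_mul_laguerreKernel_succ (a n : ℕ) :
    X * laguerreKernel a (n + 1) =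
      C (((n : ℝ) + 1 + a) * ((a + n).factorial / n.factorial)) *
        (C ((n : ℝ) + 1 + a) * laguerrePoly a (n + 1) ^ 2
          - (C (2 * (n : ℝ) + 2 + a) - X) * laguerrePoly a (n + 1) * laguerrePoly a n
          + C ((n : ℝ) + 1) * laguerrePoly a n ^ 2) := by
  induction n with
  | zero =>
    have h0 : laguerrePoly a 0 = C (1 / (a.factorial : ℝ)) := by
      simp [laguerrePoly, laguerreCoeff]
    have h1 : C ((a : ℝ) + 1) * laguerrePoly a 1 = (C ((a : ℝ) + 1) - X) * laguerrePoly a 0 := by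
      have := X_mul_derivative_laguerrePoly a 0
      rw [h0, derivative_C, mul_zero] at this
      rw [h0]
      simp only [Nat.cast_zero, zero_add, map_add, map_one] at this ⊢
      linear_combination -this
    simp only [laguerreKernel, Finset.sum_range_succ, Finset.sum_range_zero, zero_add, add_zero,
      Nat.cast_zero, Nat.factorial_zero, Nat.cast_one, div_one, C_mul, mul_zero]
    simp only [map_add, map_one, map_ofNat] at h1 ⊢
    linear_combination (-C (a.factorial : ℝ) *
      ((C (a : ℝ) + 1) * laguerrePoly a 1 - laguerrePoly a 0)) * h1
  | succ n ih =>
    rw [laguerreKernel, Finset.sum_range_succ, ← laguerreKernel, mul_add, ih]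
    have h := laguerrePoly_recurrence a n
    set k : ℝ := (a + n).factorial / (n + 1).factorial with hk
    have hf : ((a + (n + 1)).factorial : ℝ) / ((n + 1).factorial : ℝ) = ((n : ℝ) + 1 + a) * k := by
      rw [← add_assoc, Nat.factorial_succ (a + n), hk]
      push_cast
      ring
    have hg : ((a + n).factorial : ℝ) / (n.factorial : ℝ) = ((n : ℝ) + 1) * k := by
      rw [hk, Nat.factorial_succ]
      push_cast
      have : (n.factorial : ℝ) ≠ 0 := by positivity
      field_simp
    rw [hf, hg]
    push_cast
    simp only [map_add, map_mul, map_natCast, map_one, map_ofNat] at h ⊢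
    linear_combination (-((n : ℝ[X]) + 1 + a) * C k *
      (((n : ℝ[X]) + 2 + a) * laguerrePoly a (n + 2)
        - ((n : ℝ[X]) + 1) * laguerrePoly a n - laguerrePoly a (n + 1))) * h

/-! ### Intertwining relations of `fixedTraceMap`. -/

theorem simplexTerm_of_lt {E p : ℕ} (h : E < p) : simplexTerm E p = 0 := if_neg (not_le.2 h)

theorem simplexTerm_add (p n : ℕ) :
    simplexTerm (p + n) p = C (1 / (n.factorial : ℝ)) * (X ^ p * (1 - X) ^ n) := by
  rw [simplexTerm, if_pos (Nat.le_add_right p n), Nat.add_sub_cancel_left]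

theorem C_one_div_factorial_succ (n : ℕ) :
    (n + 1 : ℝ[X]) * C (1 / ((n + 1).factorial : ℝ)) = C (1 / (n.factorial : ℝ)) := by
  rw [← C_eq_natCast, ← C_1, ← C_add, ← C_mul, Nat.factorial_succ]
  congr 1
  have : (n.factorial : ℝ) ≠ 0 := by positivity
  push_cast
  field_simp

/-- The value `0` beyond `E`, in effect `1/(-1)! = 0`, makes the relation hold at `p = E` too, so no
degree bound is needed later. -/
theorem X_mul_derivative_simplexTerm (E p : ℕ) :
    X * derivative (simplexTerm E p) = (p : ℝ[X]) * simplexTerm E p - simplexTerm E (p + 1) := by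
  rcases lt_or_ge E p with h | h
  · simp [simplexTerm_of_lt h, simplexTerm_of_lt (h.trans (Nat.lt_succ_self p))]
  obtain ⟨n, rfl⟩ := Nat.exists_eq_add_of_le h
  have hX : (X : ℝ[X]) * derivative (X ^ p) = (p : ℝ[X]) * X ^ p := by
    cases p with
    | zero => simp
    | succ p => rw [derivative_X_pow, C_eq_natCast, Nat.add_sub_cancel]; ring
  cases n with
  | zero =>
    rw [simplexTerm_of_lt (Nat.lt_succ_self _), simplexTerm_add, derivative_C_mul, pow_zero, mul_one]
    linear_combination C (1 / (Nat.factorial 0 : ℝ)) * hX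
  | succ n =>
    have hd : derivative ((1 - X : ℝ[X]) ^ (n + 1)) = -((n + 1 : ℝ[X]) * (1 - X) ^ n) := by
      rw [derivative_pow_succ, derivative_sub, derivative_one, derivative_X, map_add, map_natCast,
        map_one]
      ring
    rw [simplexTerm_add, show p + (n + 1) = p + 1 + n by ring, simplexTerm_add, derivative_C_mul,
      derivative_mul, hd]
    linear_combination C (1 / ((n + 1).factorial : ℝ)) * (1 - X) ^ (n + 1) * hX -
      X ^ (p + 1) * (1 - X) ^ n * C_one_div_factorial_succ n

/-- This is `(1 - X) T_{p+1} = (E - p) X T_p`, rearranged to avoid division by `1 - X`. -/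
theorem simplexTerm_succ (E p : ℕ) :
    simplexTerm E (p + 1) = X * (((E : ℝ[X]) - (p : ℝ[X])) * simplexTerm E p + simplexTerm E (p + 1)) := by
  rcases lt_or_ge E p with h | h
  · simp [simplexTerm_of_lt h, simplexTerm_of_lt (h.trans (Nat.lt_succ_self p))]
  obtain ⟨n, rfl⟩ := Nat.exists_eq_add_of_le h
  cases n with
  | zero => simp [simplexTerm_of_lt (Nat.lt_succ_self p)]
  | succ n =>
    rw [simplexTerm_add, show p + (n + 1) = p + 1 + n by ring, simplexTerm_add]
    push_cast
    linear_combination -X ^ (p + 1) * (1 - X) ^ (n + 1) * C_one_div_factorial_succ n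

/-- The Euler operator conjugated by the exponential weight: `g ↦ x g' - x g`. -/
noncomputable def weightedEuler (g : ℝ[X]) : ℝ[X] := X * derivative g - X * g

theorem X_mul_derivative_fixedTraceMap (E : ℕ) (g : ℝ[X]) :
    X * derivative (fixedTraceMap E g) = fixedTraceMap E (weightedEuler g) := by
  induction g using Polynomial.induction_on' with
  | add p q hp hq =>
    have : weightedEuler (p + q) = weightedEuler p + weightedEuler q := by
      simp only [weightedEuler, derivative_add]; ring
    rw [this, LinearMap.map_add, LinearMap.map_add, LinearMap.map_add, mul_add, hp, hq]
  | monomial n r =>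
    have : weightedEuler (r • X ^ n) = r • ((n : ℝ) • X ^ n - X ^ (n + 1)) := by
      cases n with
      | zero => simp [weightedEuler]
      | succ n =>
        rw [weightedEuler, derivative_smul, derivative_X_pow, Nat.add_sub_cancel]
        simp only [smul_eq_C_mul]
        ring
    rw [← smul_X_eq_monomial, this]
    simp only [LinearMap.map_smul, LinearMap.map_sub]
    rw [fixedTraceMap_X_pow, fixedTraceMap_X_pow, mul_smul_comm, X_mul_derivative_simplexTerm]
    simp [smul_eq_C_mul]

theorem fixedTraceMap_X_mul (E : ℕ) (g : ℝ[X]) :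
    fixedTraceMap E (X * g) =
      X * ((E : ℝ[X]) * fixedTraceMap E g - X * derivative (fixedTraceMap E g)) := by
  induction g using Polynomial.induction_on' with
  | add p q hp hq =>
    rw [mul_add, LinearMap.map_add, LinearMap.map_add, LinearMap.map_add, hp, hq]
    ring
  | monomial n r =>
    rw [← smul_X_eq_monomial, mul_smul_comm, ← pow_succ']
    simp only [LinearMap.map_smul]
    rw [fixedTraceMap_X_pow, fixedTraceMap_X_pow, mul_smul_comm r X (derivative _),
      X_mul_derivative_simplexTerm, smul_eq_C_mul, smul_eq_C_mul, smul_eq_C_mul]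
    linear_combination C r * simplexTerm_succ E n

/-! ### The third order equations. -/

/-- A quadratic form in two functions obeying the Laguerre ladder relations satisfies a third order
differential equation, written with the intermediate function `h = (x f)' - x f`. -/
theorem quadratic_form_ode {a n W P Q f h : ℝ[X]} (ha : derivative a = 0) (hn : derivative n = 0)
    (hW : X * derivative W = a * W) (hP : X * derivative P = n * (P - Q))
    (hQ : X * derivative Q = (n + a) * P - (n + a - X) * Q)
    (hf : X * f = W * ((n + a) * (P * P) - (n + n + a - X) * (P * Q) + n * (Q * Q)))
    (hh : h = weightedEuler f + f) :
    weightedEuler (weightedEuler h) - a * a * h - X * (X * (h - f)) +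
      (a + n + n) * (X * (2 * h - f)) = 0 := by
  have hd := congrArg derivative hf
  simp only [derivative_mul, derivative_add, derivative_sub, derivative_X, ha, hn] at hd
  -- Since `h = (X f)' - X f`, differentiating the quadratic form collapses it to its mixed product,
  -- up to a factor `X` that is cancelled.
  have h0 : h = W * (P * Q) := by
    refine mul_left_cancel₀ (X_ne_zero (R := ℝ)) ?_
    rw [hh, weightedEuler]
    linear_combination X * hd - X * hf +
      ((n + a) * (P * P) - (n + n + a - X) * (P * Q) + n * (Q * Q)) * hW +
      W * (2 * (n + a) * P - (n + n + a - X) * Q) * hP +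
      W * (2 * n * Q - (n + n + a - X) * P) * hQ
  have h1 : weightedEuler h = W * ((n + a) * (P * P) - n * (Q * Q)) := by
    rw [h0, weightedEuler, derivative_mul, derivative_mul]
    linear_combination P * Q * hW + W * Q * hP + W * P * hQ
  have h2 : weightedEuler (weightedEuler h) = W * ((n + a) * (n + n + a - X) * (P * P)
      - 4 * n * (n + a) * (P * Q) + n * (n + n + a - X) * (Q * Q)) := by
    rw [h1, weightedEuler]
    simp only [derivative_mul, derivative_add, derivative_sub, ha, hn]
    linear_combination ((n + a) * (P * P) - n * (Q * Q)) * hW + 2 * W * (n + a) * P * hP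
      - 2 * W * n * Q * hQ
  rw [h2, h0]
  -- All terms are now `W` times combinations of `P²`, `PQ`, `Q²`, apart from those in `f`, which
  -- `hf` converts.
  linear_combination (X - (a + n + n)) * hf

/-- The differential equation of the density of the Laguerre unitary ensemble. -/
theorem laguerre_density_ode (a n : ℕ) (c : ℝ) {f h : ℝ[X]}
    (hf : f = c • (X ^ a * laguerreKernel a (n + 1))) (hh : h = weightedEuler f + f) :
    weightedEuler (weightedEuler h) - (a : ℝ[X]) * (a : ℝ[X]) * h - X * (X * (h - f)) +
      ((a : ℝ[X]) + ((n + 1 : ℕ) : ℝ[X]) + ((n + 1 : ℕ) : ℝ[X])) * (X * (2 * h - f)) = 0 := by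
  have hP := X_mul_derivative_laguerrePoly_succ a n
  have hQ := X_mul_derivative_laguerrePoly a n
  have hK := X_mul_laguerreKernel_succ a n
  generalize ((n : ℝ) + 1 + a) * ((a + n).factorial / n.factorial) = κ at hK
  simp only [map_add, map_mul, map_natCast, map_one, map_ofNat] at hP hQ hK
  refine quadratic_form_ode (W := C (c * κ) * X ^ a) (P := laguerrePoly a (n + 1))
    (Q := laguerrePoly a n) derivative_natCast derivative_natCast ?_ ?_ ?_ ?_ hh
  · rw [derivative_C_mul]
    cases a with
    | zero => simp
    | succ a => rw [derivative_X_pow, C_eq_natCast, Nat.add_sub_cancel]; ring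
  · push_cast
    exact hP
  · push_cast
    exact hQ
  · rw [hf, smul_eq_C_mul, C_mul]
    push_cast
    linear_combination C c * X ^ a * hK

/-- The differential equation of the fixed trace density, for the polynomial that represents it. -/
theorem fixedTrace_ode (a n E : ℕ) (c : ℝ) {r : ℝ[X]}
    (hr : r = fixedTraceMap E (c • (X ^ a * laguerreKernel a (n + 1)))) {s : ℝ[X]}
    (hs : s = X * derivative r + r) :
    X * derivative (X * derivative s) - (a : ℝ[X]) * (a : ℝ[X]) * s
      - X * ((E : ℝ[X]) * (X * ((E : ℝ[X]) * (s - r) - X * derivative (s - r)))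
        - X * derivative (X * ((E : ℝ[X]) * (s - r) - X * derivative (s - r))))
      + ((a : ℝ[X]) + ((n + 1 : ℕ) : ℝ[X]) + ((n + 1 : ℕ) : ℝ[X])) *
        (X * ((E : ℝ[X]) * (2 * s - r) - X * derivative (2 * s - r))) = 0 := by
  have hode := laguerre_density_ode a n c rfl rfl
  set f := c • (X ^ a * laguerreKernel a (n + 1)) with hf
  have hB : ∀ (k : ℕ) (g : ℝ[X]), fixedTraceMap E ((k : ℝ[X]) * g) = (k : ℝ[X]) * fixedTraceMap E g := by
    intro k g
    rw [← nsmul_eq_mul, ← nsmul_eq_mul, map_nsmul]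
  have hs' : s = fixedTraceMap E (weightedEuler f + f) := by
    rw [hs, hr, X_mul_derivative_fixedTraceMap, LinearMap.map_add]
  generalize weightedEuler f + f = h at hode hs'
  have h2 : fixedTraceMap E (2 * h - f) = 2 * s - r := by
    rw [LinearMap.map_sub, ← hr, show (2 : ℝ[X]) * h = ((2 : ℕ) : ℝ[X]) * h by push_cast; rfl, hB,
      ← hs']
    push_cast
    rfl
  have h3 : fixedTraceMap E (h - f) = s - r := by rw [LinearMap.map_sub, ← hr, hs']
  -- Transport of the Laguerre equation: each `weightedEuler` becomes `X d/dX`, each factor `X`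
  -- becomes `X (E - X d/dX)`.
  have := congrArg (fixedTraceMap E) hode
  rw [LinearMap.map_add, LinearMap.map_sub, LinearMap.map_sub, add_mul, add_mul, mul_assoc,
    LinearMap.map_add, LinearMap.map_add, hB, hB, hB, hB, fixedTraceMap_X_mul E (2 * h - f),
    fixedTraceMap_X_mul E (X * (h - f)), fixedTraceMap_X_mul E (h - f), h2, h3, map_zero,
    ← X_mul_derivative_fixedTraceMap, ← X_mul_derivative_fixedTraceMap, ← hs'] at this
  linear_combination this

end

/-! ### Conclusion for the density. -/

theorem cast_fLUEDegree (m a : ℕ) :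
    ((fLUEDegree m a : ℕ) : ℝ) = ((m + 2 : ℕ) : ℝ) ^ 2 + a * ((m + 2 : ℕ) : ℝ) - 2 := by
  simp only [fLUEDegree]
  push_cast
  ring

open Polynomial in
/-- On `(0,1)` the density is a polynomial, which solves the differential equation. -/
theorem exists_polynomial_fLUEDensity (m a : ℕ) : ∃ r : ℝ[X],
    (∀ x ∈ Set.Ioo (0 : ℝ) 1, fLUEDensity m a x = r.eval x) ∧
    ∀ x : ℝ, odeCoeff3 x * (derivative (derivative (derivative r))).eval x
        + odeCoeff2 ((m + 2 : ℕ) : ℝ) (a : ℝ) x * (derivative (derivative r)).eval x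
        + odeCoeff1 ((m + 2 : ℕ) : ℝ) (a : ℝ) x * (derivative r).eval x
        + odeCoeff0 ((m + 2 : ℕ) : ℝ) (a : ℝ) x * r.eval x = 0 := by
  obtain ⟨c, hc⟩ := mixedDiscr_laguerreHankel (m + 1) a
  refine ⟨fixedTraceMap (fLUEDegree m a)
    ((((m + 2 : ℕ) : ℝ) * (1 / fLUENorm (m + 2) a) * c) • (X ^ a * laguerreKernel a (m + 1 + 1))),
    fun x hx => ?_, fun x => ?_⟩
  · rw [fLUEDensity_eq_eval m a hx, hc, mul_smul, LinearMap.map_smul _ (_ * _), eval_smul,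
      smul_eq_mul]
  · have h := fixedTrace_ode a (m + 1) (fLUEDegree m a) (((m + 2 : ℕ) : ℝ) * (1 / fLUENorm (m + 2) a) * c)
      rfl rfl
    generalize fixedTraceMap (fLUEDegree m a)
      ((((m + 2 : ℕ) : ℝ) * (1 / fLUENorm (m + 2) a) * c) • (X ^ a * laguerreKernel a (m + 1 + 1))) = r at h ⊢
    have h' := congrArg (eval x) h
    simp only [derivative_mul, derivative_add, derivative_sub, derivative_X, derivative_natCast,
      derivative_ofNat, derivative_one, eval_add, eval_sub, eval_mul, eval_X, eval_natCast,
      eval_ofNat, eval_zero, eval_one, cast_fLUEDegree] at h'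
    simp only [odeCoeff0, odeCoeff1, odeCoeff2, odeCoeff3]
    push_cast at h' ⊢
    linear_combination h'

theorem mainTheorem3 (m a : ℕ) :
    (∀ x ∈ Set.Ioo (0 : ℝ) 1,
      Integrable (fun y : Fin (m + 1) → ℝ =>
        fLUEFactor (m + 2) a (Fin.cons x y : Fin (m + 2) → ℝ)) (traceDelta m (1 - x))) ∧
    ContDiffOn ℝ 3 (fLUEDensity m a) (Set.Ioo 0 1) ∧
    ∀ x ∈ Set.Ioo (0 : ℝ) 1,
      odeCoeff3 x * iteratedDeriv 3 (fLUEDensity m a) x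
        + odeCoeff2 ((m + 2 : ℕ) : ℝ) (a : ℝ) x * iteratedDeriv 2 (fLUEDensity m a) x
        + odeCoeff1 ((m + 2 : ℕ) : ℝ) (a : ℝ) x * deriv (fLUEDensity m a) x
        + odeCoeff0 ((m + 2 : ℕ) : ℝ) (a : ℝ) x * fLUEDensity m a x = 0 := by
  obtain ⟨r, hr, hode⟩ := exists_polynomial_fLUEDensity m a
  refine ⟨fun x hx => integrable_fLUEFactor_cons m a hx, ?_, fun x hx => ?_⟩
  · have h : ContDiff ℝ 3 fun x : ℝ => Polynomial.aeval x r := Polynomial.contDiff_aeval r 3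
    exact h.contDiffOn.congr fun x hx => by rw [hr x hx, Polynomial.coe_aeval_eq_eval]
  · have he : fLUEDensity m a =ᶠ[nhds x] fun x => r.eval x :=
      Filter.eventuallyEq_of_mem (isOpen_Ioo.mem_nhds hx) hr
    have hd : ∀ p : Polynomial ℝ, deriv (fun x => p.eval x) = fun x => p.derivative.eval x :=
      fun p => funext fun x => p.deriv
    rw [he.iteratedDeriv_eq 3, he.iteratedDeriv_eq 2, he.deriv_eq, hr x hx]
    simp only [iteratedDeriv_succ, iteratedDeriv_zero, hd]
    exact hode x
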